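/- Let $\mathcal H$ be a complex Hilbert space with inner product $\langle\cdot|\cdot\rangle$ (linear in the first variable) and norm $\|\cdot\|$, and let $\mathcal D\subseteq\mathcal H$ be a dense subspace. Definitions. A sesquilinear form $\Omega$ on $\mathcal D$ is *q-closed* with respect to a norm $\|\cdot\|_\Omega$ on $\mathcal D$ if $\mathcal D[\|\cdot\|_\Omega]$ is a reflexive Banach space and there are $\alpha,\beta>0$ with $\|\xi\|\le\alpha\|\xi\|_\Omega$ and $|\Omega(\xi,\eta)|\le\beta\|\xi\|_\Omega\|\eta\|_\Omega$ for all $\xi,\eta\in\mathcal D$. It is *solvable* with respect to $\|\cdot\|_\Omega$ if it is q-closed with respect to $\|\cdot\|_\Omega$ and there is a bounded sesquilinear form $\Upsilon$ on $\mathcal H$ such that (i) if $\xi\in\mathcal D$ and $(\Omega+\Upsilon)(\xi,\eta)=0$ for all $\eta\in\mathcal D$, then $\xi=0$; and (ii) for every bounded conjugate linear functional $\Lambda$ on $\mathcal D[\|\cdot\|_\Omega]$ there is $\xi\in\mathcal D$ with $\Lambda(\eta)=(\Omega+\Upsilon)(\xi,\eta)$ for all $\eta\in\mathcal D$. It is solvable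 with respect to an inner product on $\mathcal D$ if it is solvable with respect to the norm induced by it. The *operator associated* to $\Omega$ is the operator $T$ with domain $D(T)=\{\xi\in\mathcal D:\ \exists\chi\in\mathcal H\ \forall\eta\in\mathcal D\ \ \Omega(\xi,\eta)=\langle\chi|\eta\rangle\}$ and $T\xi=\chi$. The resolvent set $\rho(T)$ is the set of $\lambda\in\mathbb C$ for which $T-\lambda I$ (with domain $D(T)$) has an everywhere defined bounded inverse, and $\sigma(T)=\mathbb C\setminus\rho(T)$. The spectrum is *purely discrete* if every $\lambda\in\sigma(T)$ is an eigenvalue of $T$ of finite multiplicity $\dim\ker(T-\lambda I)$ and $\sigma(T)$ has no accumulation point in $\mathbb C$. Theorem. Let $\Omega$ be a sesquilinear form on $\mathcal D$ that is solvable with respect to an inner product $\langle\cdot|\cdot\rangle_\Omega$ on $\mathcal D$, let $T$ be its associated operator, and suppose that the embedding $\mathcal D[\langle\cdot|\cdot\rangle_\Omega]\hookrightarrow\mathcal H$ is compact. 1. If $A$ is a bounded operator on $\mathcal H$ and $T-A$ (with domain $D(T)$) has an everywhere defined bounded inverse $(T-A)^{-1}$ on $\mathcal H$, then $(T-A)^{-1}$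 is compact. 2. In particular, for every $\lambda\in\rho(T)$ the resolvent $(T-\lambda I)^{-1}$ is compact. 3. If $\sigma(T)\ne\mathbb C$, then $\sigma(T)$ is purely discrete. -/

import Mathlib

open Filter Topology

namespace SesqForm

universe u

variable {H : Type u} [NormedAddCommGroup H] [InnerProductSpace ℂ H] {D : Submodule ℂ H}

/-! ### Norms on the domain of a form -/

/-- A norm on a complex vector space `V`. (It is used for the domain `V = D` of a form, where it is
in general unrelated to the norm that `D` inherits from `H`.) -/
structure DomainNorm (V : Type u) [AddCommGroup V] [Module ℂ V] extends Seminorm ℂ V where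
  eq_zero_of_apply_eq_zero : ∀ ξ : V, toFun ξ = 0 → ξ = 0

/-- The norm `√⟨ξ, ξ⟩` induced by an inner product. -/
noncomputable def DomainNorm.ofInner {V : Type u} [AddCommGroup V] [Module ℂ V]
    (c : InnerProductSpace.Core ℂ V) : DomainNorm V where
  toFun ξ := Real.sqrt (c.inner ξ ξ).re
  map_zero' := by
    let := c.toNormedAddCommGroup
    exact norm_zero (E := V)
  add_le' ξ η := by
    let := c.toNormedAddCommGroup
    exact norm_add_le (E := V) ξ η
  neg' ξ := by
    let := c.toNormedAddCommGroup
    exact norm_neg (E := V) ξ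
  smul' a ξ := by
    let := c.toNormedAddCommGroup
    let : NormedSpace ℂ V := InnerProductSpace.Core.toNormedSpace
    exact norm_smul (β := V) a ξ
  eq_zero_of_apply_eq_zero ξ h := by
    let := c.toNormedAddCommGroup
    exact norm_eq_zero (E := V) |>.1 h

/-- The normed space `V[n]`: the vector space `V` with the norm `n`. This is a type synonym of `V`,
so that no other norm or topology that `V` may have is used on it. -/
def NormedDomain {V : Type u} [AddCommGroup V] [Module ℂ V] (_n : DomainNorm V) : Type u := V

namespace NormedDomain

variable {V : Type u} [AddCommGroup V] [Module ℂ V] (n : DomainNorm V)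

instance : AddCommGroup (NormedDomain n) := inferInstanceAs (AddCommGroup V)

instance : Module ℂ (NormedDomain n) := inferInstanceAs (Module ℂ V)

noncomputable instance : NormedAddCommGroup (NormedDomain n) :=
  AddGroupNorm.toNormedAddCommGroup
    { toFun := fun ξ : NormedDomain n => n.toSeminorm (ξ : V)
      map_zero' := map_zero n.toSeminorm
      add_le' := fun ξ η => map_add_le_add n.toSeminorm (ξ : V) (η : V)
      neg' := fun ξ => map_neg_eq_map n.toSeminorm (ξ : V)
      eq_zero_of_map_eq_zero' := fun ξ h => n.eq_zero_of_apply_eq_zero (ξ : V) h }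

noncomputable instance : NormedSpace ℂ (NormedDomain n) where
  norm_smul_le a ξ := (map_smul_eq_mul n.toSeminorm a (ξ : V)).le

/-- The identity map of `V`, as a linear equivalence from `V[n]` to `V`. -/
def toDomain : NormedDomain n ≃ₗ[ℂ] V := LinearEquiv.refl ℂ V

theorem norm_def (ξ : NormedDomain n) : ‖ξ‖ = n.toSeminorm (toDomain n ξ) := rfl

end NormedDomain

/-- The embedding `D[n] → H`, for a norm `n` on a subspace `D` of `H`. -/
def NormedDomain.embed (n : DomainNorm D) : NormedDomain n →ₗ[ℂ] H :=
  D.subtype ∘ₗ (NormedDomain.toDomain n).toLinearMap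

/-! ### q-closed and solvable forms -/

/-- A complex normed space is a reflexive Banach space if it is complete and its canonical
embedding into its bidual is surjective. -/
def IsReflexiveBanach (E : Type*) [NormedAddCommGroup E] [NormedSpace ℂ E] : Prop :=
  CompleteSpace E ∧ Function.Surjective (NormedSpace.inclusionInDoubleDual ℂ E)

/-- `Ω`, a sesquilinear form on `D` (linear in the first and conjugate linear in the second
variable), is q-closed with respect to the norm `n`: the embedding `D[n] → H` is continuous,
`D[n]` is a reflexive Banach space, and `Ω` is bounded on `D[n]`. -/
structure IsQClosed (Ω : D →ₗ[ℂ] D →ₗ⋆[ℂ] ℂ) (n : DomainNorm D) : Prop where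
  embedding_bounded : ∃ α : ℝ, 0 < α ∧ ∀ ξ : D, ‖(ξ : H)‖ ≤ α * n.toSeminorm ξ
  reflexive : IsReflexiveBanach (NormedDomain n)
  form_bounded : ∃ β : ℝ, 0 < β ∧ ∀ ξ η : D, ‖Ω ξ η‖ ≤ β * n.toSeminorm ξ * n.toSeminorm η

/-- The set of bounded sesquilinear forms `Υ` on `H` such that `Ω + Υ` has trivial kernel
`{ξ | (Ω + Υ)(ξ, η) = 0 for all η}` and such that every bounded conjugate linear functional on
`D[n]` is of the form `η ↦ (Ω + Υ)(ξ, η)` with `ξ ∈ D`. -/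
def perturbations (Ω : D →ₗ[ℂ] D →ₗ⋆[ℂ] ℂ) (n : DomainNorm D) : Set (H →L[ℂ] H →L⋆[ℂ] ℂ) :=
  {Υ | (∀ ξ : D, (∀ η : D, Ω ξ η + Υ (ξ : H) (η : H) = 0) → ξ = 0) ∧
    ∀ Λ : NormedDomain n →L⋆[ℂ] ℂ, ∃ ξ : D, ∀ η : NormedDomain n,
      Λ η = Ω ξ (NormedDomain.toDomain n η) + Υ (ξ : H) (NormedDomain.embed n η)}

/-- `Ω` is solvable with respect to the norm `n`. -/
structure IsSolvable (Ω : D →ₗ[ℂ] D →ₗ⋆[ℂ] ℂ) (n : DomainNorm D) : Prop where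
  qClosed : IsQClosed Ω n
  perturbations_nonempty : (perturbations Ω n).Nonempty

/-! ### The operator associated to a form -/

/-- The pairs `(ξ, χ) ∈ D × H` such that `Ω(ξ, η) = ⟨χ, η⟩` for all `η ∈ D`. (Mathlib's
`inner ℂ η χ` is linear in `χ`.) -/
def associatedGraph (Ω : D →ₗ[ℂ] D →ₗ⋆[ℂ] ℂ) : Submodule ℂ (H × H) where
  carrier := {p | ∃ ξ : D, (ξ : H) = p.1 ∧ ∀ η : D, Ω ξ η = inner ℂ (η : H) p.2}
  zero_mem' := ⟨0, rfl, fun η => by simp⟩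
  add_mem' := by
    rintro p q ⟨ξ, hξ, h⟩ ⟨ξ', hξ', h'⟩
    exact ⟨ξ + ξ', by simp [hξ, hξ'], fun η => by simp [h, h']⟩
  smul_mem' := by
    rintro a p ⟨ξ, hξ, h⟩
    exact ⟨a • ξ, by simp [hξ], fun η => by simp [h]⟩

/-- The operator `T` associated to `Ω`, for `D` dense in `H`: its domain consists of the `ξ ∈ D`
for which there is `χ ∈ H` with `Ω(ξ, η) = ⟨χ, η⟩` for all `η ∈ D`, and `T ξ = χ`. For every
bounded form `Υ(ξ, η) = ⟨B ξ, η⟩` this is the operator `S - B`, where `S` is the restriction of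
`ξ ↦ (Ω + Υ)(ξ, ·)` to those `ξ ∈ D` which it sends into `H`. -/
noncomputable def associatedOperator (Ω : D →ₗ[ℂ] D →ₗ⋆[ℂ] ℂ) : H →ₗ.[ℂ] H :=
  (associatedGraph Ω).toLinearPMap

/-- If `D` is dense then the graph of the associated operator is `associatedGraph Ω`. -/
theorem graph_associatedOperator (hD : Dense (D : Set H)) (Ω : D →ₗ[ℂ] D →ₗ⋆[ℂ] ℂ) :
    (associatedOperator Ω).graph = associatedGraph Ω := by
  refine Submodule.toLinearPMap_graph_eq _ ?_
  rintro ⟨x, χ⟩ ⟨ξ, hξ, h⟩ hx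
  have hξ0 : ξ = 0 := Subtype.ext (by simpa using hξ.trans hx)
  refine hD.eq_zero_of_inner_right (𝕜 := ℂ) fun v hv => ?_
  have := h ⟨v, hv⟩
  simpa [hξ0] using this.symm

/-! ### Bounded inverses, spectrum -/

/-- The operator `T - A` with the domain of `T`, for `A` a bounded operator. -/
def subBounded (T : H →ₗ.[ℂ] H) (A : H →L[ℂ] H) : H →ₗ.[ℂ] H := (-A).toLinearMap +ᵥ T

/-- `S` is an everywhere defined bounded inverse of the operator `T`. -/
def IsBoundedInverse (T : H →ₗ.[ℂ] H) (S : H →L[ℂ] H) : Prop :=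
  (∀ ξ : T.domain, S (T ξ) = ξ) ∧ ∀ χ : H, ∃ ξ : T.domain, (ξ : H) = S χ ∧ T ξ = χ

/-- The operator `T - λ I`, with the domain of `T`. -/
noncomputable def shift (T : H →ₗ.[ℂ] H) (z : ℂ) : H →ₗ.[ℂ] H :=
  subBounded T (z • ContinuousLinearMap.id ℂ H)

/-- The resolvent set `ρ(T)`: the `λ ∈ ℂ` for which `T - λ I` has a bounded inverse on `H`. -/
def resolventSet (T : H →ₗ.[ℂ] H) : Set ℂ := {z | ∃ S : H →L[ℂ] H, IsBoundedInverse (shift T z) S}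

/-- The spectrum `σ(T) = ℂ \ ρ(T)`. -/
def spectrum (T : H →ₗ.[ℂ] H) : Set ℂ := (resolventSet T)ᶜ

/-- The eigenspace `ker (T - λ I)`, as a subspace of `H`. -/
noncomputable def eigenspace (T : H →ₗ.[ℂ] H) (z : ℂ) : Submodule ℂ H :=
  (LinearMap.ker (shift T z).toFun).map (shift T z).domain.subtype

/-- The spectrum of `T` is purely discrete: every `λ ∈ σ(T)` is an eigenvalue of finite
multiplicity `dim ker (T - λ I)`, and `σ(T)` has no (finite) accumulation point in `ℂ`. -/
structure HasPurelyDiscreteSpectrum (T : H →ₗ.[ℂ] H) : Prop where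
  eigenvalue : ∀ z ∈ spectrum T, eigenspace T z ≠ ⊥
  finite_multiplicity : ∀ z ∈ spectrum T, FiniteDimensional ℂ (eigenspace T z)
  no_accumulation : ∀ z : ℂ, ¬ AccPt z (𝓟 (spectrum T))

end SesqForm

/-! The inverse `S` of `T - A` factors through the compact embedding of `D[n]`. Choose an admissible
perturbation `Υ`. If `ξ = S χ`, then `T ξ = χ + A ξ`, so `(Ω + Υ)(ξ, ·)` is the functional `⟨χ + A S
χ, ·⟩ + Υ(S χ, ·)`, which depends boundedly on `χ`. Solvability and the open mapping theorem recover
`ξ` from it by a bounded map into `D[n]` (`exists_solution_operator`). Resolvents are the case `A =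
λ I`.

For the spectrum, take one compact resolvent `R` at `z₀`. Away from `z₀`, `z` corresponds to `(z -
z₀)⁻¹` for `R`, and the Fredholm alternative makes every spectral point an eigenvalue. Infinite
multiplicity or an accumulation point would give independent eigenvectors of `R` with eigenvalues
bounded away from zero, against compactness. -/

open scoped InnerProductSpace

/-! ### Eigenvectors of compact operators -/

section CompactOperators

variable {H : Type*} [NormedAddCommGroup H] [InnerProductSpace ℂ H]

/-- A compact operator has no sequence of linearly independent eigenvectors whose eigenvalues are
bounded away from zero. -/
theorem IsCompactOperator.not_linearIndependent_of_le_norm_eigenvalue {R : H →L[ℂ] H}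
    (hR : IsCompactOperator R) {μ : ℕ → ℂ} {v : ℕ → H} (hv : ∀ n, R (v n) = μ n • v n) {ε : ℝ}
    (hε : 0 < ε) (hμ : ∀ n, ε ≤ ‖μ n‖) : ¬ LinearIndependent ℂ v := by
  intro hli
  let e := InnerProductSpace.gramSchmidtNormed ℂ v
  have hon : Orthonormal ℂ e := InnerProductSpace.gramSchmidtNormed_orthonormal hli
  have hspan : ∀ n, Submodule.span ℂ (e '' Set.Iio n) = Submodule.span ℂ (v '' Set.Iio n) :=
    fun n => by
      rw [InnerProductSpace.span_gramSchmidtNormed, InnerProductSpace.span_gramSchmidt_Iio]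
  have hRspan : ∀ n, ∀ x ∈ Submodule.span ℂ (v '' Set.Iio n),
      R x ∈ Submodule.span ℂ (v '' Set.Iio n) := by
    intro n x hx
    induction hx using Submodule.span_induction with
    | mem x hx =>
      obtain ⟨m, hm, rfl⟩ := hx
      rw [hv]
      exact Submodule.smul_mem _ _ (Submodule.subset_span ⟨m, hm, rfl⟩)
    | zero => simp
    | add x y _ _ hx hy => rw [map_add]; exact Submodule.add_mem _ hx hy
    | smul a x _ hx => rw [map_smul]; exact Submodule.smul_mem _ _ hx
  have horth : ∀ n, ∀ x ∈ Submodule.span ℂ (v '' Set.Iio n), ⟪e n, x⟫_ℂ = 0 := by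
    intro n x hx
    rw [← hspan] at hx
    induction hx using Submodule.span_induction with
    | mem x hx =>
      obtain ⟨m, hm, rfl⟩ := hx
      exact hon.2 (ne_of_gt hm)
    | zero => simp
    | add x y _ _ hx hy => rw [inner_add_right, hx, hy, add_zero]
    | smul a x _ hx => rw [inner_smul_right, hx, mul_zero]
  -- `R` is triangular in the Gram–Schmidt basis with diagonal `μ n`, so the images `R (e n)` are
  -- `ε`-separated.
  have hsub : ∀ n, R (e n) - μ n • e n ∈ Submodule.span ℂ (v '' Set.Iio n) := by
    intro n
    obtain ⟨a, w, hw, he⟩ : ∃ a : ℂ, ∃ w ∈ Submodule.span ℂ (v '' Set.Iio n),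
        e n = a • v n + w := by
      have hmem : InnerProductSpace.gramSchmidt ℂ v n - v n ∈
          Submodule.span ℂ (v '' Set.Iio n) := by
        have h := InnerProductSpace.gramSchmidt_def'' ℂ v n
        rw [← InnerProductSpace.span_gramSchmidt_Iio, ← neg_sub, sub_eq_iff_eq_add'.2 h]
        exact Submodule.neg_mem _ (Submodule.sum_mem _ fun i hi => Submodule.smul_mem _ _
          (Submodule.subset_span (Set.mem_image_of_mem _ (Finset.mem_Iio.1 hi))))
      refine ⟨((‖InnerProductSpace.gramSchmidt ℂ v n‖ : ℂ))⁻¹,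
        ((‖InnerProductSpace.gramSchmidt ℂ v n‖ : ℂ))⁻¹ •
          (InnerProductSpace.gramSchmidt ℂ v n - v n), Submodule.smul_mem _ _ hmem, ?_⟩
      rw [← smul_add, add_sub_cancel]
      rfl
    have : R (e n) - μ n • e n = R w - μ n • w := by
      rw [he, map_add, map_smul, hv, smul_add, smul_comm a]
      abel
    rw [this]
    exact Submodule.sub_mem _ (hRspan n w hw) (Submodule.smul_mem _ _ hw)
  have hmem : ∀ n, e n ∈ Submodule.span ℂ (v '' Set.Iio (n + 1)) := by
    intro n
    rw [← hspan]
    exact Submodule.subset_span ⟨n, Nat.lt_succ_self n, rfl⟩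
  have hsep : ∀ m n, m < n → ε ≤ dist (R (e n)) (R (e m)) := by
    intro m n hmn
    have h1 : ⟪e n, R (e m)⟫_ℂ = 0 := by
      refine horth n _ (Submodule.span_mono (Set.image_mono (Set.Iio_subset_Iio ?_))
        (hRspan (m + 1) _ (hmem m)))
      exact hmn
    have h2 : ⟪e n, R (e n)⟫_ℂ = μ n := by
      have := horth n _ (hsub n)
      rw [inner_sub_right, inner_smul_right, inner_self_eq_norm_sq_to_K, hon.1 n] at this
      simpa [sub_eq_zero] using this
    calc ε ≤ ‖μ n‖ := hμ n
      _ = ‖⟪e n, R (e n) - R (e m)⟫_ℂ‖ := by rw [inner_sub_right, h1, h2, sub_zero]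
      _ ≤ ‖e n‖ * ‖R (e n) - R (e m)‖ := norm_inner_le_norm _ _
      _ = dist (R (e n)) (R (e m)) := by rw [hon.1 n, one_mul, dist_eq_norm]
  obtain ⟨K, hK, hsubK⟩ := hR.image_closedBall_subset_compact (f := (R : H →ₗ[ℂ] H)) 1
  obtain ⟨y, -, φ, hφ, hlim⟩ := hK.tendsto_subseq (x := fun n => R (e n))
    fun n => hsubK ⟨e n, by simp [hon.1 n], rfl⟩
  obtain ⟨N, hN⟩ := Metric.cauchySeq_iff.1 hlim.cauchySeq ε hε
  exact absurd (hN (N + 1) (Nat.le_succ N) N le_rfl)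
    (not_lt.2 (hsep _ _ (hφ (Nat.lt_succ_self N))))

end CompactOperators

namespace SesqForm

/-! ### From resolvent to spectrum -/

section BoundedInverse

variable {H : Type*} [NormedAddCommGroup H] [InnerProductSpace ℂ H]

theorem subBounded_apply (T : H →ₗ.[ℂ] H) (A : H →L[ℂ] H) (ξ : T.domain) :
    subBounded T A ξ = T ξ - A ξ :=
  (LinearPMap.vadd_apply (-A).toLinearMap T ξ).trans (neg_add_eq_sub _ _)

theorem isBoundedInverse_subBounded_iff {T : H →ₗ.[ℂ] H} {A S : H →L[ℂ] H} :
    IsBoundedInverse (subBounded T A) S ↔ (∀ ξ : T.domain, S (T ξ - A ξ) = ξ) ∧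
      ∀ χ : H, ∃ ξ : T.domain, (ξ : H) = S χ ∧ T ξ - A ξ = χ := by
  have h := subBounded_apply T A
  constructor
  · rintro ⟨h1, h2⟩
    exact ⟨fun ξ => (congrArg S (h ξ)).symm.trans (h1 ξ), fun χ =>
      let ⟨ξ, hξ, hξ'⟩ := h2 χ; ⟨ξ, hξ, (h ξ).symm.trans hξ'⟩⟩
  · rintro ⟨h1, h2⟩
    exact ⟨fun ξ => (congrArg S (h ξ)).trans (h1 ξ), fun χ =>
      let ⟨ξ, hξ, hξ'⟩ := h2 χ; ⟨ξ, hξ, (h ξ).trans hξ'⟩⟩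

theorem isBoundedInverse_shift_iff {T : H →ₗ.[ℂ] H} {z : ℂ} {S : H →L[ℂ] H} :
    IsBoundedInverse (shift T z) S ↔ (∀ ξ : T.domain, S (T ξ - z • (ξ : H)) = ξ) ∧
      ∀ χ : H, ∃ ξ : T.domain, (ξ : H) = S χ ∧ T ξ - z • (ξ : H) = χ :=
  isBoundedInverse_subBounded_iff

theorem mem_eigenspace_iff {T : H →ₗ.[ℂ] H} {z : ℂ} {x : H} :
    x ∈ eigenspace T z ↔ ∃ ξ : T.domain, (ξ : H) = x ∧ T ξ = z • x := by
  have h : ∀ ξ : T.domain, (shift T z).toFun ξ = T ξ - z • (ξ : H) :=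
    subBounded_apply T _
  constructor
  · rintro ⟨ξ, hξ, rfl⟩
    exact ⟨ξ, rfl, sub_eq_zero.1 ((h ξ).symm.trans hξ)⟩
  · rintro ⟨ξ, rfl, hξ⟩
    exact ⟨ξ, (h ξ).trans (sub_eq_zero.2 hξ), rfl⟩

/-- The eigenspaces of an operator are those of its resolvent. -/
theorem eigenspace_eq_eigenspace_resolvent {T : H →ₗ.[ℂ] H} {z₀ z : ℂ} (hz : z ≠ z₀)
    {R : H →L[ℂ] H} (hR : IsBoundedInverse (shift T z₀) R) :
    eigenspace T z = Module.End.eigenspace (R : Module.End ℂ H) (z - z₀)⁻¹ := by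
  obtain ⟨h1, h2⟩ := isBoundedInverse_shift_iff.1 hR
  have hz' : z - z₀ ≠ 0 := sub_ne_zero.2 hz
  ext x
  rw [mem_eigenspace_iff, Module.End.mem_eigenspace_iff]
  constructor
  · rintro ⟨ξ, rfl, hξ⟩
    have := h1 ξ
    rw [hξ, ← sub_smul, map_smul] at this
    rw [eq_inv_smul_iff₀ hz']
    exact this
  · intro hx
    obtain ⟨ξ, hξ, hξ'⟩ := h2 ((z - z₀) • x)
    have hξx : (ξ : H) = x := by
      rw [hξ, map_smul]
      exact (eq_inv_smul_iff₀ hz').1 hx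
    refine ⟨ξ, hξx, ?_⟩
    rw [sub_eq_iff_eq_add, hξx, ← add_smul, sub_add_cancel] at hξ'
    exact hξ'

/-- The spectral mapping theorem for the resolvent, in one direction. -/
theorem mem_resolventSet_of_mem_resolventSet_resolvent {T : H →ₗ.[ℂ] H} {z₀ z : ℂ} (hz : z ≠ z₀)
    {R : H →L[ℂ] H} (hR : IsBoundedInverse (shift T z₀) R)
    (h : (z - z₀)⁻¹ ∈ _root_.resolventSet ℂ R) : z ∈ resolventSet T := by
  obtain ⟨h1, h2⟩ := isBoundedInverse_shift_iff.1 hR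
  have hz' : z - z₀ ≠ 0 := sub_ne_zero.2 hz
  obtain ⟨u, hu⟩ := h
  have hu' : ∀ x, (u : H →L[ℂ] H) x = (z - z₀)⁻¹ • x - R x := fun x => by
    rw [hu, Algebra.algebraMap_eq_smul_one]
    rfl
  let W : H →L[ℂ] H := ↑u⁻¹
  have hWu : ∀ x, W ((u : H →L[ℂ] H) x) = x := fun x =>
    congrArg (fun f : H →L[ℂ] H => f x) u.inv_mul
  have huW : ∀ x, (u : H →L[ℂ] H) (W x) = x := fun x =>
    congrArg (fun f : H →L[ℂ] H => f x) u.mul_inv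
  refine ⟨(z - z₀)⁻¹ • R ∘L W, isBoundedInverse_shift_iff.2 ⟨fun ξ => ?_, fun χ => ?_⟩⟩
  -- With `u = (z - z₀)⁻¹ - R`, on the domain `T - z = (z - z₀) u (T - z₀)`; this dictates the
  -- candidate inverse.
  · have hξ : T ξ - z • (ξ : H) = (z - z₀) • (u : H →L[ℂ] H) (T ξ - z₀ • (ξ : H)) := by
      rw [hu', h1, smul_sub, smul_inv_smul₀ hz', sub_smul]
      abel
    rw [hξ]
    change (z - z₀)⁻¹ • R (W _) = _
    rw [map_smul, hWu, map_smul, h1, inv_smul_smul₀ hz']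
  · obtain ⟨ξ, hξ, hξ'⟩ := h2 ((z - z₀)⁻¹ • W χ)
    refine ⟨ξ, by rw [hξ, map_smul]; rfl, ?_⟩
    have h3 := hu' (W χ)
    rw [huW] at h3
    have h4 : T ξ - z • (ξ : H) = (T ξ - z₀ • (ξ : H)) - (z - z₀) • (ξ : H) := by
      rw [sub_smul]
      abel
    rw [h4, hξ', hξ, map_smul, smul_inv_smul₀ hz', ← h3]

/-- An operator with a compact resolvent has purely discrete spectrum. -/
theorem hasPurelyDiscreteSpectrum_of_isCompactOperator_resolvent [CompleteSpace H]
    {T : H →ₗ.[ℂ] H} {z₀ : ℂ} {R : H →L[ℂ] H} (hR : IsBoundedInverse (shift T z₀) R)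
    (hc : IsCompactOperator R) : HasPurelyDiscreteSpectrum T := by
  have hne : ∀ z ∈ spectrum T, z ≠ z₀ := by
    rintro z hz rfl
    exact hz ⟨R, hR⟩
  have hev : ∀ z ∈ spectrum T,
      Module.End.HasEigenvalue (R : Module.End ℂ H) (z - z₀)⁻¹ := fun z hz =>
    (hc.hasEigenvalue_or_mem_resolventSet (inv_ne_zero (sub_ne_zero.2 (hne z hz)))).resolve_right
      fun h => hz (mem_resolventSet_of_mem_resolventSet_resolvent (hne z hz) hR h)
  refine ⟨fun z hz => ?_, fun z hz => ?_, fun z hz => ?_⟩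
  · rw [eigenspace_eq_eigenspace_resolvent (hne z hz) hR]
    exact hev z hz
  · rw [eigenspace_eq_eigenspace_resolvent (hne z hz) hR]
    by_contra hfin
    obtain ⟨v, hv⟩ : ∃ v : ℕ → Module.End.eigenspace (R : Module.End ℂ H) (z - z₀)⁻¹,
        LinearIndependent ℂ v := by
      have hrank := not_lt.1 (mt Module.rank_lt_aleph0_iff.1 hfin)
      obtain ⟨s, hs, hli⟩ := le_rank_iff_exists_linearIndependent.1 hrank
      have : Infinite s := Cardinal.infinite_iff.2 hs.ge
      exact ⟨_, hli.comp _ (Infinite.natEmbedding s).injective⟩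
    refine hc.not_linearIndependent_of_le_norm_eigenvalue (μ := fun _ => (z - z₀)⁻¹)
      (v := fun n => (v n : H)) (fun n => Module.End.mem_eigenspace_iff.1 (v n).2)
      (norm_pos_iff.2 (inv_ne_zero (sub_ne_zero.2 (hne z hz)))) (fun _ => le_rfl) ?_
    exact hv.map' (Submodule.subtype _) (Submodule.ker_subtype _)
  · have hinf : (Metric.ball z 1 ∩ spectrum T).Infinite := by
      rw [accPt_iff_frequently_nhdsNE] at hz
      intro hfin
      have h1 : ∀ᶠ w in 𝓝[≠] z, w ∈ Metric.ball z 1 :=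
        mem_nhdsWithin_of_mem_nhds (Metric.ball_mem_nhds z one_pos)
      -- A finite set with `z` removed is closed, so its complement is a neighbourhood of `z`.
      have h2 : ∀ᶠ w in 𝓝[≠] z, w ∉ Metric.ball z 1 ∩ spectrum T := by
        rw [eventually_nhdsWithin_iff]
        filter_upwards [(hfin.subset Set.sdiff_subset).isClosed.isOpen_compl.mem_nhds
          (show z ∉ (Metric.ball z 1 ∩ spectrum T) \ {z} from fun h => h.2 rfl)] with w hw hwz hw'
        exact hw ⟨hw', hwz⟩
      exact hz (by filter_upwards [h1, h2] with w hw hw' hw'' using hw' ⟨hw, hw''⟩)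
    let w := hinf.natEmbedding
    have hw : ∀ n, (w n : ℂ) ∈ spectrum T := fun n => (w n).2.2
    choose v hv using fun n => (hev _ (hw n)).exists_hasEigenvector
    refine hc.not_linearIndependent_of_le_norm_eigenvalue (μ := fun n => ((w n : ℂ) - z₀)⁻¹)
      (v := v) (fun n => Module.End.mem_eigenspace_iff.1 (hv n).1)
      -- The points `w n` lie within distance `1` of `z`, hence `‖w n - z₀‖ ≤ 1 + ‖z - z₀‖`.
      (ε := (1 + ‖z - z₀‖)⁻¹) (by positivity) (fun n => ?_) ?_
    · rw [norm_inv]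
      refine inv_anti₀ (norm_pos_iff.2 (sub_ne_zero.2 (hne _ (hw n)))) ?_
      have h1 : ‖(w n : ℂ) - z‖ < 1 := mem_ball_iff_norm.1 (w n).2.1
      have h2 := norm_add_le ((w n : ℂ) - z) (z - z₀)
      rw [sub_add_sub_cancel] at h2
      linarith
    · refine Module.End.eigenvectors_linearIndependent' (R : Module.End ℂ H) _ ?_ v hv
      intro m n hmn
      exact w.injective (Subtype.ext (sub_left_injective (inv_injective hmn)))

end BoundedInverse

/-! ### Solvability and compactness of the inverse -/

section Solvable

variable {H : Type*} [NormedAddCommGroup H] [InnerProductSpace ℂ H] {D : Submodule ℂ H}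

/-- If `Υ` is an admissible perturbation of `Ω`, then the solution operator of the equation
`(Ω + Υ)(ξ, ·) = F` is bounded from the conjugate dual of `H` to `D[n]`. -/
theorem IsQClosed.exists_solution_operator {Ω : D →ₗ[ℂ] D →ₗ⋆[ℂ] ℂ} {n : DomainNorm D}
    (hΩ : IsQClosed Ω n) {Υ : H →L[ℂ] H →L⋆[ℂ] ℂ} (hΥ : Υ ∈ perturbations Ω n) :
    ∃ G : (H →L⋆[ℂ] ℂ) →L[ℂ] NormedDomain n, ∀ (ξ : D) (F : H →L⋆[ℂ] ℂ),
      (∀ η : D, Ω ξ η + Υ (ξ : H) (η : H) = F η) → NormedDomain.embed n (G F) = ξ := by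
  obtain ⟨α, hα, hemb⟩ := hΩ.embedding_bounded
  obtain ⟨β, hβ, hform⟩ := hΩ.form_bounded
  have : CompleteSpace (NormedDomain n) := hΩ.reflexive.1
  let J : NormedDomain n →L[ℂ] H := (NormedDomain.embed n).mkContinuous α fun ξ => hemb ξ
  let X₁ : NormedDomain n →L[ℂ] NormedDomain n →L⋆[ℂ] ℂ :=
    LinearMap.mkContinuous₂ (σ₁₃ := RingHom.id ℂ) (σ₂₃ := starRingEnd ℂ)
      (Ω : NormedDomain n →ₗ[ℂ] NormedDomain n →ₗ⋆[ℂ] ℂ) β hform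
  let X : NormedDomain n →L[ℂ] NormedDomain n →L⋆[ℂ] ℂ := X₁ + Υ.bilinearComp J J
  have hbij : Function.Bijective X := by
    refine ⟨(injective_iff_map_eq_zero X).2 fun ξ hξ => hΥ.1 ξ fun η => ?_, fun Λ => ?_⟩
    · exact congrArg (fun f : NormedDomain n →L⋆[ℂ] ℂ => f η) hξ
    · obtain ⟨ξ, hξ⟩ := hΥ.2 Λ
      exact ⟨ξ, ContinuousLinearMap.ext fun η => (hξ η).symm⟩
  -- Open mapping theorem: `D[n]` and its conjugate dual are Banach spaces.
  let e := ContinuousLinearEquiv.ofBijective X (LinearMap.ker_eq_bot.2 hbij.1)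
    (LinearMap.range_eq_top.2 hbij.2)
  let j : (H →L⋆[ℂ] ℂ) →L[ℂ] NormedDomain n →L⋆[ℂ] ℂ := ContinuousLinearMap.precomp ℂ J
  refine ⟨(e.symm : _ →L[ℂ] NormedDomain n) ∘L j, fun ξ F h => ?_⟩
  have hξ : e ((NormedDomain.toDomain n).symm ξ) = j F := ContinuousLinearMap.ext fun η => h η
  exact congrArg (NormedDomain.embed n) ((e.symm_apply_eq).2 hξ.symm)

/-- `S` equals the embedding composed with the bounded map `G ∘L F` into `D[n]`, where `F χ` is the
functional that `(Ω + Υ)(S χ, ·)` must equal. -/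
theorem isCompactOperator_of_isBoundedInverse_subBounded [CompleteSpace H]
    (hD : Dense (D : Set H)) {Ω : D →ₗ[ℂ] D →ₗ⋆[ℂ] ℂ} {n : DomainNorm D} (hΩ : IsSolvable Ω n)
    (hcomp : IsCompactOperator (NormedDomain.embed n)) {A S : H →L[ℂ] H}
    (hS : IsBoundedInverse (subBounded (associatedOperator Ω) A) S) : IsCompactOperator S := by
  obtain ⟨Υ, hΥ⟩ := hΩ.perturbations_nonempty
  obtain ⟨G, hG⟩ := hΩ.qClosed.exists_solution_operator hΥ
  let F : H →L[ℂ] H →L⋆[ℂ] ℂ := (innerSL ℂ).flip ∘L (.id ℂ H + A ∘L S) + Υ ∘L S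
  have hF : ∀ χ y, F χ y = inner ℂ y (χ + A (S χ)) + Υ (S χ) y := fun χ y => rfl
  have key : ∀ χ, NormedDomain.embed n (G (F χ)) = S χ := by
    intro χ
    obtain ⟨ξ, hξ, hξ'⟩ := (isBoundedInverse_subBounded_iff.1 hS).2 χ
    have hmem := (associatedOperator Ω).mem_graph ξ
    rw [graph_associatedOperator hD] at hmem
    obtain ⟨x, hx, h⟩ := hmem
    replace hx : (x : H) = S χ := hx.trans hξ
    rw [← hx]
    refine hG x _ fun η => ?_
    rw [h, hF, ← hx, hx, ← hξ, ← hξ', sub_add_cancel]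
  rw [← funext key]
  exact hcomp.comp_clm (G ∘L F)

end Solvable

end SesqForm


theorem mainTheorem8 {H : Type*} [NormedAddCommGroup H] [InnerProductSpace ℂ H] [CompleteSpace H]
    (D : Submodule ℂ H) (hD : Dense (D : Set H))
    (Ω : D →ₗ[ℂ] D →ₗ⋆[ℂ] ℂ)
    (c : InnerProductSpace.Core ℂ D)
    (hΩ : SesqForm.IsSolvable Ω (SesqForm.DomainNorm.ofInner c))
    (hcomp : IsCompactOperator (SesqForm.NormedDomain.embed (SesqForm.DomainNorm.ofInner c))) :
    (∀ A S : H →L[ℂ] H,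
      SesqForm.IsBoundedInverse (SesqForm.subBounded (SesqForm.associatedOperator Ω) A) S →
        IsCompactOperator S) ∧
    (∀ z ∈ SesqForm.resolventSet (SesqForm.associatedOperator Ω),
      ∃ R : H →L[ℂ] H,
        SesqForm.IsBoundedInverse (SesqForm.shift (SesqForm.associatedOperator Ω) z) R ∧
          IsCompactOperator R) ∧
    (SesqForm.spectrum (SesqForm.associatedOperator Ω) ≠ Set.univ →
      SesqForm.HasPurelyDiscreteSpectrum (SesqForm.associatedOperator Ω)) := by
  have h1 : ∀ A S : H →L[ℂ] H,
      SesqForm.IsBoundedInverse (SesqForm.subBounded (SesqForm.associatedOperator Ω) A) S →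
        IsCompactOperator S := fun A S hS =>
    SesqForm.isCompactOperator_of_isBoundedInverse_subBounded hD hΩ hcomp hS
  refine ⟨h1, fun z ⟨R, hR⟩ => ⟨R, hR, h1 _ R hR⟩, fun hσ => ?_⟩
  obtain ⟨z₀, hz₀⟩ := (Set.ne_univ_iff_exists_notMem _).1 hσ
  obtain ⟨R, hR⟩ := not_not.1 hz₀
  exact SesqForm.hasPurelyDiscreteSpectrum_of_isCompactOperator_resolvent hR (h1 _ R hR)
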